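/- Let $X$ be a zero-dimensional Polish space, that is, a separable completely metrizable topological space in which the clopen sets form a base of the topology. Call a continuous map $f\colon X\to X$ fixed-point free if $f(x)\neq x$ for all $x\in X$, and colorable if there is a finite cover $\mathcal F$ of $X$ by closed subsets of $X$ such that $f(F)\cap F=\emptyset$ for every $F\in\mathcal F$. Then the following conditions are equivalent: (1) every continuous fixed-point free self-map of $X$ is colorable; (2) $X$ is $\sigma$-compact, that is, a union of countably many compact subsets. -/

import Mathlib

/-- A self-map `f : X → X` is colorable if `X` has a finite cover by closed sets each of which
is disjoint from its image under `f`. -/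
def IsColorable {X : Type*} [TopologicalSpace X] (f : X → X) : Prop :=
  ∃ F : Set (Set X), F.Finite ∧ (∀ A ∈ F, IsClosed A ∧ Disjoint (f '' A) A) ∧ ⋃₀ F = Set.univ

/-! If `X` is σ-compact, a clopen partition gives a continuous proper coloring by ℕ. Along every
orbit the colors are eventually dominated by one sequence `β`; cutting ℕ into blocks at the values
of `β` reduces the colors to finitely many (`isColorable_of_continuous_nat`).

If `X` is not σ-compact, the Baire space is a retract of it (`exists_baire_retract`), and a map of
the Baire space transfers through the retraction. There `freeShift` is not colorable: an ultrafilter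
argument yields a color class containing some `(n, m, z)` together with its shift `(m, z)`, where `n
≠ m`. -/

open Set Filter Topology

/-! ### Clopen partitions indexed by ℕ -/

section ClopenCover

variable {X : Type*} [TopologicalSpace X]

open Classical in
/-- The first index of a clopen cover containing a point depends continuously on the point. -/
theorem continuous_find_clopen {C : ℕ → Set X} (hC : ∀ k, IsClopen (C k))
    (h : ∀ x, ∃ k, x ∈ C k) : Continuous fun x => Nat.find (h x) := by
  refine continuous_discrete_rng.2 fun k => ?_
  have : (fun x => Nat.find (h x)) ⁻¹' {k} = C k ∩ ⋂ j ∈ Finset.range k, (C j)ᶜ := by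
    ext x
    simp [Nat.find_eq_iff]
  rw [this]
  exact (hC k).isOpen.inter (isOpen_biInter_finset fun j _ => (hC j).compl.isOpen)

/-- A neighbourhood assignment on a second countable space with a clopen base is refined by a
countable clopen partition. -/
theorem exists_continuous_nat_refining [SecondCountableTopology X]
    (hX : TopologicalSpace.IsTopologicalBasis {U : Set X | IsClopen U})
    {U : X → Set X} (hU : ∀ x, U x ∈ 𝓝 x) :
    ∃ q : X → ℕ, Continuous q ∧ ∀ y, ∃ x, ∀ z, q z = q y → z ∈ U x := by
  classical
  rcases isEmpty_or_nonempty X with hE | hE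
  · exact ⟨fun _ => 0, continuous_const, fun y => (hE.false y).elim⟩
  have hbase : ∀ x, ∃ C : Set X, IsClopen C ∧ x ∈ C ∧ C ⊆ U x := fun x => by
    obtain ⟨C, hC, hxC, hCU⟩ := hX.mem_nhds_iff.1 (hU x)
    exact ⟨C, hC, hxC, hCU⟩
  choose C hC hxC hCU using hbase
  obtain ⟨s, hs, hcov⟩ :=
    TopologicalSpace.countable_cover_nhds fun x => (hC x).isOpen.mem_nhds (hxC x)
  have hne : s.Nonempty := by
    by_contra hs'
    rw [not_nonempty_iff_eq_empty.1 hs'] at hcov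
    simp [eq_comm (a := (∅ : Set X))] at hcov
  obtain ⟨e, rfl⟩ := hs.exists_eq_range hne
  have h : ∀ x, ∃ k, x ∈ C (e k) := fun x => by
    have hx : x ∈ ⋃ y ∈ range e, C y := hcov ▸ mem_univ x
    simpa using hx
  refine ⟨fun x => Nat.find (h x), continuous_find_clopen (fun k => hC (e k)) h, fun y =>
    ⟨e (Nat.find (h y)), fun z hz => hCU _ ?_⟩⟩
  have := Nat.find_spec (h z)
  simp only at hz
  rwa [hz] at this

end ClopenCover

/-! ### Finite colorings on σ-compact spaces -/

section SigmaCompact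

variable {X : Type*} [TopologicalSpace X]

/-- A clopen set that every orbit leaves can be two-colored. -/
theorem exists_bool_coloring_of_leaves {f : X → X} (hf : Continuous f) {P : Set X}
    (hP : IsClopen P) (hleave : ∀ x, ∃ k, x ∈ f^[k] ⁻¹' Pᶜ) :
    ∃ c : X → Bool, Continuous c ∧ ∀ x ∈ P, c (f x) ≠ c x := by
  classical
  let t : X → ℕ := fun x => Nat.find (hleave x)
  have ht : Continuous t := continuous_find_clopen (C := fun k => f^[k] ⁻¹' Pᶜ)
    (fun k => hP.compl.preimage (hf.iterate k)) hleave
  -- Color by the parity of the exit time, which drops by one at each step inside `P`.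
  refine ⟨fun x => (t x).bodd, (continuous_of_discreteTopology (f := Nat.bodd)).comp ht,
    fun x hx => ?_⟩
  have hsucc : t x = t (f x) + 1 :=
    Nat.find_comp_succ (hleave x) (hleave (f x)) (by simpa using hx)
  simp [hsucc]

/-- On a `σ`-compact space, the sequences `k ↦ n (f^[k] x)` are all eventually dominated by a
single sequence. -/
theorem exists_eventually_iterate_le [SigmaCompactSpace X] {f : X → X} (hf : Continuous f)
    {n : X → ℕ} (hn : Continuous n) :
    ∃ β : ℕ → ℕ, (∀ k, k ≤ β k) ∧ ∀ x, ∀ᶠ k in atTop, n (f^[k] x) ≤ β k := by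
  have hb : ∀ j k, ∃ b, ∀ x ∈ compactCovering X j, n (f^[k] x) ≤ b := fun j k => by
    obtain ⟨b, hb⟩ := ((isCompact_compactCovering X j).image
      (hn.comp (hf.iterate k))).bddAbove
    exact ⟨b, fun x hx => hb ⟨x, hx, rfl⟩⟩
  choose b hb using hb
  -- The summand `k` makes `β` unbounded, so that every natural number falls into a block.
  refine ⟨fun k => k + ∑ j ∈ Finset.range (k + 1), b j k, fun k => Nat.le_add_right _ _,
    fun x => ?_⟩
  obtain ⟨j, hj⟩ := exists_mem_compactCovering x
  filter_upwards [eventually_ge_atTop j] with k hk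
  calc n (f^[k] x) ≤ b j k := hb j k x hj
    _ ≤ ∑ j ∈ Finset.range (k + 1), b j k :=
      Finset.single_le_sum (f := fun j => b j k) (fun _ _ => Nat.zero_le _)
        (Finset.mem_range.2 (by omega))
    _ ≤ _ := Nat.le_add_left _ _

theorem isColorable_of_continuous {ι : Type*} [Finite ι] [TopologicalSpace ι]
    [DiscreteTopology ι] {f : X → X} {c : X → ι} (hc : Continuous c)
    (h : ∀ x, c (f x) ≠ c x) : IsColorable f := by
  refine ⟨range fun i => c ⁻¹' {i}, finite_range _, ?_, ?_⟩
  · rintro _ ⟨i, rfl⟩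
    refine ⟨(isClosed_discrete {i}).preimage hc, Set.disjoint_left.2 ?_⟩
    rintro _ ⟨x, hx, rfl⟩ hfx
    exact h x (hfx.trans hx.symm)
  · exact eq_univ_of_forall fun x => ⟨_, ⟨c x, rfl⟩, rfl⟩

/-- On a `σ`-compact space, a continuous proper coloring by natural numbers can be replaced by a
finite one. -/
theorem isColorable_of_continuous_nat [SigmaCompactSpace X] {f : X → X} (hf : Continuous f)
    {n : X → ℕ} (hn : Continuous n) (hnf : ∀ x, n (f x) ≠ n x) : IsColorable f := by
  classical
  obtain ⟨β, hβ, hdom⟩ := exists_eventually_iterate_le hf hn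
  have hex : ∀ m, ∃ k, m ≤ β k := fun m => ⟨m, hβ m⟩
  let blk : ℕ → ℕ := fun m => Nat.find (hex m)
  have hblk : ∀ m, m ≤ β (blk m) := fun m => Nat.find_spec (hex m)
  have hblk_le : ∀ {m k}, m ≤ β k → blk m ≤ k := fun h => Nat.find_min' (hex _) h
  have hmono : Monotone blk := fun m m' h => hblk_le (h.trans (hblk m'))
  have hnf' : Continuous fun x => (n x, n (f x)) := hn.prodMk (hn.comp hf)
  have clopen : ∀ S : Set (ℕ × ℕ), IsClopen ((fun x => (n x, n (f x))) ⁻¹' S) :=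
    fun S => (isClopen_discrete S).preimage hnf'
  have iter : ∀ x k, f (f^[k] x) = f^[k + 1] x := fun x k =>
    (Function.iterate_succ_apply' f k x).symm
  -- Four kinds of steps from `n x` to `n (f x)` are colored separately. The first three cannot
  -- recur forever: descents, rises within a block, and jumps of at least two blocks.
  obtain ⟨c₁, hc₁, h₁⟩ := exists_bool_coloring_of_leaves hf (clopen {a | a.2 < a.1}) (by
    intro x
    by_contra! h
    have key : ∀ k, n (f^[k] x) + k ≤ n x := by
      intro k
      induction k with
      | zero => simp
      | succ k ih =>
        have := h k
        simp only [mem_preimage, mem_compl_iff, mem_ofPred_eq, not_not, iter] at this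
        omega
    have := key (n x + 1)
    omega)
  obtain ⟨c₂, hc₂, h₂⟩ := exists_bool_coloring_of_leaves hf
    (clopen {a | a.1 < a.2 ∧ blk a.2 = blk a.1}) (by
    intro x
    by_contra! h
    have key : ∀ k, k ≤ n (f^[k] x) ∧ blk (n (f^[k] x)) = blk (n x) := by
      intro k
      induction k with
      | zero => simp
      | succ k ih =>
        have := h k
        simp only [mem_preimage, mem_compl_iff, mem_ofPred_eq, not_not, iter] at this
        omega
    obtain ⟨hk, hb⟩ := key (β (blk (n x)) + 1)
    have := hblk (n (f^[β (blk (n x)) + 1] x))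
    rw [hb] at this
    omega)
  obtain ⟨c₃, hc₃, h₃⟩ := exists_bool_coloring_of_leaves hf
    (clopen {a | blk a.1 + 2 ≤ blk a.2}) (by
    intro x
    by_contra! h
    have key : ∀ k, 2 * k ≤ blk (n (f^[k] x)) := by
      intro k
      induction k with
      | zero => simp
      | succ k ih =>
        have := h k
        simp only [mem_preimage, mem_compl_iff, mem_ofPred_eq, not_not, iter] at this
        omega
    -- Domination puts the `k`-th iterate in block at most `k`, against `2 * k`; this needs `k ≥ 1`.
    obtain ⟨k, hk, hk1⟩ := ((hdom x).and (eventually_ge_atTop 1)).exists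
    have := key k
    have := hblk_le hk
    omega)
  -- The remaining steps pass to the next block, so block parity changes.
  have hc₄ : Continuous fun x => (blk (n x)).bodd :=
    (continuous_of_discreteTopology (f := fun m => (blk m).bodd)).comp hn
  refine isColorable_of_continuous (hc₁.prodMk (hc₂.prodMk (hc₃.prodMk hc₄))) fun x hx => ?_
  simp only [Prod.mk.injEq] at hx
  obtain ⟨e₁, e₂, e₃, e₄⟩ := hx
  have g₁ : ¬ n (f x) < n x := fun h => h₁ x h e₁
  have g₂ : ¬ (n x < n (f x) ∧ blk (n (f x)) = blk (n x)) := fun h => h₂ x h e₂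
  have g₃ : ¬ blk (n x) + 2 ≤ blk (n (f x)) := fun h => h₃ x h e₃
  have lt : n x < n (f x) := lt_of_le_of_ne (not_lt.1 g₁) (hnf x).symm
  have le := hmono lt.le
  have succ : blk (n (f x)) = blk (n x) + 1 := by
    have : blk (n (f x)) ≠ blk (n x) := fun h => g₂ ⟨lt, h⟩
    omega
  simp [succ] at e₄

theorem isColorable_of_sigmaCompactSpace [T2Space X] [SecondCountableTopology X]
    [SigmaCompactSpace X] (hX : TopologicalSpace.IsTopologicalBasis {U : Set X | IsClopen U})
    {f : X → X} (hf : Continuous f) (hfix : ∀ x, f x ≠ x) : IsColorable f := by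
  have hU : ∀ x, ∃ U ∈ 𝓝 x, Disjoint (f '' U) U := fun x => by
    obtain ⟨V, W, hV, hW, hxV, hxW, hVW⟩ := t2_separation (hfix x)
    refine ⟨f ⁻¹' V ∩ W, inter_mem (hf.continuousAt (hV.mem_nhds hxV)) (hW.mem_nhds hxW),
      hVW.mono ?_ inter_subset_right⟩
    rintro _ ⟨y, hy, rfl⟩
    exact hy.1
  choose U hUx hUd using hU
  obtain ⟨n, hn, hnU⟩ := exists_continuous_nat_refining hX hUx
  refine isColorable_of_continuous_nat hf hn fun x hx => ?_
  obtain ⟨y, hy⟩ := hnU x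
  exact Set.disjoint_left.1 (hUd y) ⟨x, hy x rfl, rfl⟩ (hy (f x) hx)

end SigmaCompact

/-! ### A fixed-point free map of the Baire space that is not colorable -/

section Shift

/-- Prepend a value to a sequence. -/
def seqCons (n : ℕ) (y : ℕ → ℕ) : ℕ → ℕ
  | 0 => n
  | k + 1 => y k

theorem continuous_seqCons (n : ℕ) : Continuous (seqCons n) := by
  refine continuous_pi fun k => ?_
  cases k with
  | zero => exact continuous_const
  | succ k => exact continuous_apply k

/-- The sets of sequences that a player choosing `𝒱`-many values at each turn can force to be
entered after finitely many turns. -/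
inductive Forced (𝒱 : Filter ℕ) : Set (ℕ → ℕ) → Prop
  | univ : Forced 𝒱 univ
  | step {U : Set (ℕ → ℕ)} {S : Set ℕ} (hS : S ∈ 𝒱)
      (h : ∀ n ∈ S, Forced 𝒱 (seqCons n ⁻¹' U)) : Forced 𝒱 U

namespace Forced

variable {𝒱 : Filter ℕ} {U V : Set (ℕ → ℕ)}

theorem eventually_section (h : Forced 𝒱 U) : ∀ᶠ n in 𝒱, Forced 𝒱 (seqCons n ⁻¹' U) := by
  cases h with
  | univ => exact Eventually.of_forall fun n => Forced.univ
  | step hS h => exact mem_of_superset hS h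

theorem of_eventually_section (h : ∀ᶠ n in 𝒱, Forced 𝒱 (seqCons n ⁻¹' U)) : Forced 𝒱 U :=
  step h fun _ hn => hn

theorem inter (hU : Forced 𝒱 U) (hV : Forced 𝒱 V) : Forced 𝒱 (U ∩ V) := by
  induction hU generalizing V with
  | univ => rwa [univ_inter]
  | step hS _ ih =>
    refine of_eventually_section ?_
    filter_upwards [hS, hV.eventually_section] with n hn hVn
    exact ih n hn hVn

theorem biInter {ι : Type*} {s : Set ι} (hs : s.Finite) {U : ι → Set (ℕ → ℕ)}
    (h : ∀ i ∈ s, Forced 𝒱 (U i)) : Forced 𝒱 (⋂ i ∈ s, U i) := by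
  induction s, hs using Set.Finite.induction_on with
  | empty => simpa using Forced.univ
  | insert _ _ ih =>
    rw [biInter_insert]
    exact (h _ (mem_insert _ _)).inter (ih fun i hi => h i (mem_insert_of_mem _ hi))

theorem nonempty [𝒱.NeBot] (h : Forced 𝒱 U) : U.Nonempty := by
  induction h with
  | univ => exact univ_nonempty
  | step hS _ ih =>
    obtain ⟨n, hn⟩ := Filter.nonempty_of_mem hS
    obtain ⟨y, hy⟩ := ih n hn
    exact ⟨_, hy⟩

/-- Here the ultrafilter property matters: failures on large sets of values can be intersected, so
several unforced sets are avoided by one choice. -/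
theorem eventually_not_section {𝒱 : Ultrafilter ℕ} (h : ¬ Forced 𝒱 U) :
    ∀ᶠ n in (𝒱 : Filter ℕ), ¬ Forced 𝒱 (seqCons n ⁻¹' U) :=
  Ultrafilter.eventually_not.2 fun h' => h (of_eventually_section h')

end Forced

/-- The section of a set of sequences along the first `k` values of `y`. -/
def seqSection (U : Set (ℕ → ℕ)) (y : ℕ → ℕ) : ℕ → Set (ℕ → ℕ)
  | 0 => U
  | k + 1 => seqCons (y k) ⁻¹' seqSection U y k

theorem mem_seqSection {U : Set (ℕ → ℕ)} {y : ℕ → ℕ} (k : ℕ) (z : ℕ → ℕ) :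
    z ∈ seqSection U y k ↔ (fun i => if i < k then y i else z (i - k)) ∈ U := by
  induction k generalizing z with
  | zero => simp [seqSection]
  | succ k ih =>
    rw [seqSection, mem_preimage, ih]
    refine iff_of_eq (congrArg (· ∈ U) (funext fun i => ?_))
    rcases lt_trichotomy i k with h | rfl | h
    · simp [h, h.trans (Nat.lt_succ_self k)]
    · simp [seqCons]
    · obtain ⟨j, rfl⟩ := Nat.exists_eq_add_of_lt h
      have h1 : k + j + 1 - k = j + 1 := by omega
      have h2 : k + j + 1 - (k + 1) = j := by omega
      have h3 : ¬ k + j + 1 < k := by omega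
      have h4 : ¬ k + j + 1 < k + 1 := by omega
      simp only [h1, h2, h3, h4, if_false, seqCons]

theorem notMem_of_seqSection_ne_univ {U : Set (ℕ → ℕ)} (hU : IsOpen U) {y : ℕ → ℕ}
    (h : ∀ k, seqSection U y k ≠ univ) : y ∉ U := by
  intro hy
  have : ∀ k, ∃ z, z ∉ seqSection U y k := fun k => (ne_univ_iff_exists_notMem _).1 (h k)
  choose z hz using this
  have lim : Tendsto (fun k i => if i < k then y i else z k (i - k)) atTop (𝓝 y) := by
    refine tendsto_pi_nhds.2 fun i => tendsto_const_nhds.congr' ?_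
    filter_upwards [eventually_gt_atTop i] with k hk
    simp [hk]
  obtain ⟨k, hk⟩ := (lim.eventually (hU.mem_nhds hy)).exists
  exact hz k ((mem_seqSection k _).2 hk)

/-- Two open sets that cannot be forced with respect to an ultrafilter do not cover. -/
theorem exists_notMem_of_not_forced {𝒱 : Ultrafilter ℕ} {U V : Set (ℕ → ℕ)} (hU : IsOpen U)
    (hV : IsOpen V) (hU' : ¬ Forced 𝒱 U) (hV' : ¬ Forced 𝒱 V) : ∃ y, y ∉ U ∧ y ∉ V := by
  let St := {A : Set (ℕ → ℕ) × Set (ℕ → ℕ) // ¬ Forced 𝒱 A.1 ∧ ¬ Forced 𝒱 A.2}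
  have next : ∀ A : St, ∃ n, ¬ Forced 𝒱 (seqCons n ⁻¹' A.1.1) ∧
      ¬ Forced 𝒱 (seqCons n ⁻¹' A.1.2) := fun A =>
    ((Forced.eventually_not_section A.2.1).and (Forced.eventually_not_section A.2.2)).exists
  choose m hm using next
  let A : ℕ → St := fun k => Nat.rec ⟨(U, V), hU', hV'⟩
    (fun _ A => ⟨(seqCons (m A) ⁻¹' A.1.1, seqCons (m A) ⁻¹' A.1.2), hm A⟩) k
  have hA : ∀ k, (A k).1 = (seqSection U (fun k => m (A k)) k,
      seqSection V (fun k => m (A k)) k) := by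
    intro k
    induction k with
    | zero => rfl
    | succ k ih =>
      have h : (A (k + 1)).1 = (seqCons (m (A k)) ⁻¹' (A k).1.1,
        seqCons (m (A k)) ⁻¹' (A k).1.2) := rfl
      rw [h, ih]
      rfl
  refine ⟨fun k => m (A k), notMem_of_seqSection_ne_univ hU fun k hk => ?_,
    notMem_of_seqSection_ne_univ hV fun k hk => ?_⟩
  · apply (A k).2.1
    rw [hA, hk]
    exact Forced.univ
  · apply (A k).2.2
    rw [hA, hk]
    exact Forced.univ

/-- The shift, modified on the sequences whose first two values agree so as to have no fixed
point. -/
def freeShift (y : ℕ → ℕ) : ℕ → ℕ :=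
  if y 0 = y 1 then seqCons (y 0 + 1) fun k => y (k + 1) else fun k => y (k + 1)

theorem freeShift_ne (y : ℕ → ℕ) : freeShift y ≠ y := by
  intro h
  have h0 := congrFun h 0
  unfold freeShift at h0
  split_ifs at h0 with h1
  · simp [seqCons] at h0
  · exact h1 h0.symm

theorem continuous_freeShift : Continuous freeShift := by
  have hclopen : IsClopen {y : ℕ → ℕ | y 0 = y 1} :=
    (isClopen_discrete {a : ℕ × ℕ | a.1 = a.2}).preimage
      (f := fun y : ℕ → ℕ => (y 0, y 1)) ((continuous_apply 0).prodMk (continuous_apply 1))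
  refine Continuous.if (fun y hy => ?_) ?_ ?_
  · rw [hclopen.frontier_eq] at hy
    exact hy.elim
  · refine continuous_pi fun k => ?_
    cases k with
    | zero => exact (continuous_apply (A := fun _ => ℕ) 0).add continuous_const
    | succ k => exact continuous_apply (k + 1)
  · exact continuous_pi fun k => continuous_apply (k + 1)

theorem not_isColorable_freeShift : ¬ IsColorable freeShift := by
  rintro ⟨F, hF, hA, hcov⟩
  let 𝒱 : Ultrafilter ℕ := hyperfilter ℕ
  -- Otherwise the complements of the color classes would have a forced, hence nonempty,
  -- intersection.
  have hnot : ∃ A ∈ F, ¬ Forced 𝒱 Aᶜ := by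
    by_contra! h
    obtain ⟨y, hy⟩ := (Forced.biInter hF h).nonempty
    have hy' : y ∈ ⋃₀ F := hcov ▸ mem_univ y
    obtain ⟨A, hAF, hyA⟩ := hy'
    exact mem_iInter₂.1 hy A hAF hyA
  obtain ⟨A, hAF, hAn⟩ := hnot
  have hopen : IsOpen Aᶜ := (hA A hAF).1.isOpen_compl
  obtain ⟨n, hn⟩ := (Forced.eventually_not_section hAn).exists
  have hne : ∀ᶠ m in (𝒱 : Filter ℕ), m ≠ n :=
    hyperfilter_le_cofinite (finite_singleton n).compl_mem_cofinite
  obtain ⟨m, ⟨hm, hnm⟩, hmn⟩ := (((Forced.eventually_not_section hAn).and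
    (Forced.eventually_not_section hn)).and hne).exists
  obtain ⟨z, hz, hz'⟩ := exists_notMem_of_not_forced
    (hopen.preimage (continuous_seqCons m))
    ((hopen.preimage (continuous_seqCons n)).preimage (continuous_seqCons m)) hm hnm
  have hz₁ : seqCons m z ∈ A := not_not.1 hz
  have hz₂ : seqCons n (seqCons m z) ∈ A := not_not.1 hz'
  refine Set.disjoint_left.1 (hA A hAF).2 ⟨_, hz₂, ?_⟩ hz₁
  exact if_neg (Ne.symm hmn)

end Shift

/-! ### Retraction onto the Baire space -/

section Retract

theorem IsColorable.of_conj {X Y : Type*} [TopologicalSpace X] [TopologicalSpace Y]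
    {f : X → X} {g : Y → Y} {σ : Y → X} (hσ : Continuous σ) (h : ∀ y, f (σ y) = σ (g y))
    (hf : IsColorable f) : IsColorable g := by
  obtain ⟨F, hF, hA, hcov⟩ := hf
  refine ⟨preimage σ '' F, hF.image _, ?_, eq_univ_of_forall fun y => ?_⟩
  · rintro _ ⟨A, hAF, rfl⟩
    refine ⟨(hA A hAF).1.preimage hσ, Set.disjoint_left.2 ?_⟩
    rintro _ ⟨y, hy, rfl⟩ hgy
    exact Set.disjoint_left.1 (hA A hAF).2 ⟨σ y, hy, h y⟩ hgy
  · have hy : σ y ∈ ⋃₀ F := hcov ▸ mem_univ _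
    obtain ⟨A, hAF, hyA⟩ := hy
    exact ⟨_, ⟨A, hAF, rfl⟩, hyA⟩

variable {X : Type*}

/-- A closed set that is not `σ`-compact is split by a continuous function to `ℕ` into
infinitely many parts, each having a small closed subset that is not `σ`-compact. -/
theorem exists_continuous_nat_splitting [MetricSpace X] [CompleteSpace X]
    [SecondCountableTopology X]
    (hX : TopologicalSpace.IsTopologicalBasis {U : Set X | IsClopen U}) {D : Set X}
    (hD : IsClosed D) (hDσ : ¬ IsSigmaCompact D) {ε : ℝ} (hε : 0 < ε) :
    ∃ p : X → ℕ, Continuous p ∧ ∃ C : ℕ → Set X, ∀ n, IsClosed (C n) ∧ ¬ IsSigmaCompact (C n) ∧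
      C n ⊆ D ∧ (∀ x ∈ C n, p x = n) ∧ ∀ x ∈ C n, ∀ y ∈ C n, dist x y < ε := by
  have hq : ∀ l : ℕ, ∃ q : X → ℕ, Continuous q ∧
      ∀ x y, q x = q y → dist x y < ε / (l + 1) := fun l => by
    have hpos : 0 < ε / (l + 1) / 2 := by positivity
    obtain ⟨q, hq, h⟩ := exists_continuous_nat_refining hX fun x => Metric.ball_mem_nhds x hpos
    refine ⟨q, hq, fun x y hxy => ?_⟩
    obtain ⟨z, hz⟩ := h y
    have h₁ : dist x z < _ := hz x hxy
    have h₂ : dist y z < _ := hz y rfl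
    linarith [dist_triangle_right x y z]
  choose q hq hqd using hq
  let I : ℕ → Set ℕ := fun l => {i | ¬ IsSigmaCompact (D ∩ q l ⁻¹' {i})}
  have hclosed : ∀ l (S : Set ℕ), IsClosed (q l ⁻¹' S) := fun l S =>
    (isClosed_discrete S).preimage (hq l)
  by_cases hI : ∃ l, (I l).Infinite
  · obtain ⟨l, hl⟩ := hI
    let e := Nat.nth (· ∈ I l)
    have he : Function.Injective e := Nat.nth_injective hl
    refine ⟨fun x => Function.invFun e (q l x), 
      (continuous_of_discreteTopology (f := Function.invFun e)).comp (hq l),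
      fun n => D ∩ q l ⁻¹' {e n}, fun n => ⟨hD.inter (hclosed l _), ?_, inter_subset_left,
      ?_, ?_⟩⟩
    · exact Nat.nth_mem_of_infinite hl n
    · rintro x ⟨-, hx⟩
      have hx : q l x = e n := hx
      simp only [hx]
      exact Function.leftInverse_invFun he n
    · rintro x ⟨-, hx⟩ y ⟨-, hy⟩
      refine (hqd l x y (Eq.trans hx (Eq.symm hy))).trans_le (div_le_self hε.le ?_)
      linarith [(Nat.cast_nonneg l : (0 : ℝ) ≤ l)]
  · exfalso
    apply hDσ
    simp only [not_exists, Set.not_infinite] at hI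
    -- `K` keeps the points whose piece is not σ-compact at any scale. With finitely many such
    -- pieces per scale it is totally bounded; the rest of `D` is a countable union of σ-compact
    -- pieces.
    let K : Set X := D ∩ ⋂ l, q l ⁻¹' I l
    have hK : IsCompact K := by
      refine TotallyBounded.isCompact_of_isClosed ?_
        (hD.inter (isClosed_iInter fun l => hclosed l _))
      refine Metric.totallyBounded_of_finite_discretization fun δ hδ => ?_
      obtain ⟨l, hl⟩ := exists_nat_gt (ε / δ)
      have hl' : ε / (l + 1) < δ := by
        rw [div_lt_iff₀ hδ] at hl
        rw [div_lt_iff₀ (by positivity)]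
        nlinarith
      have : Fintype (I l) := (hI l).fintype
      refine ⟨ULift (I l), inferInstance, fun x => ⟨q l x, mem_iInter.1 x.2.2 l⟩, fun x y hxy => ?_⟩
      exact (hqd l x y (congrArg (fun i => i.down.1) hxy)).trans hl'
    have hcov : D = K ∪ ⋃ a : {a : ℕ × ℕ // a.2 ∉ I a.1}, D ∩ q a.1.1 ⁻¹' {a.1.2} := by
      ext x
      refine ⟨fun hx => ?_, ?_⟩
      · by_cases h : ∀ l, q l x ∈ I l
        · exact Or.inl ⟨hx, mem_iInter.2 h⟩
        · obtain ⟨l, hl⟩ := not_forall.1 h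
          exact Or.inr (mem_iUnion.2 ⟨⟨(l, q l x), hl⟩, hx, rfl⟩)
      · rintro (hx | hx)
        · exact hx.1
        · obtain ⟨a, ha⟩ := mem_iUnion.1 hx
          exact ha.1
    have hrest : IsSigmaCompact (⋃ a : {a : ℕ × ℕ // a.2 ∉ I a.1}, D ∩ q a.1.1 ⁻¹' {a.1.2}) :=
      isSigmaCompact_iUnion _ fun a => not_not.1 a.2
    rw [hcov, ← sUnion_pair]
    refine isSigmaCompact_sUnion _ (to_countable _) ?_
    rintro ⟨s, rfl | rfl⟩
    · exact hK.isSigmaCompact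
    · exact hrest

/-- The Baire space is a retract of every zero-dimensional Polish space that is not
`σ`-compact. -/
theorem exists_baire_retract [TopologicalSpace X] [PolishSpace X]
    (hX : TopologicalSpace.IsTopologicalBasis {U : Set X | IsClopen U})
    (hσ : ¬ SigmaCompactSpace X) :
    ∃ (π : X → ℕ → ℕ) (σ : (ℕ → ℕ) → X), Continuous π ∧ Continuous σ ∧ ∀ y, π (σ y) = y := by
  let _ := TopologicalSpace.upgradeIsCompletelyMetrizable X
  let B := {D : Set X // IsClosed D ∧ ¬ IsSigmaCompact D}
  have hsplit : ∀ (k : ℕ) (D : B), ∃ p : X → ℕ, Continuous p ∧ ∃ C : ℕ → Set X, ∀ n,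
      IsClosed (C n) ∧ ¬ IsSigmaCompact (C n) ∧ C n ⊆ D.1 ∧ (∀ x ∈ C n, p x = n) ∧
      ∀ x ∈ C n, ∀ y ∈ C n, dist x y < 1 / ((k : ℝ) + 1) := fun k D =>
    exists_continuous_nat_splitting hX D.2.1 D.2.2 Nat.one_div_pos_of_nat
  choose p hp C hC using hsplit
  let next : ℕ → B → ℕ → B := fun k D n => ⟨C k D n, (hC k D n).1, (hC k D n).2.1⟩
  let top : B := ⟨univ, isClosed_univ, fun h => hσ (isSigmaCompact_univ_iff.1 h)⟩
  let S : (ℕ → ℕ) → ℕ → B := fun y k => Nat.rec top (fun k D => next k D (y k)) k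
  -- `T` follows the splitting functions even at points outside the chosen pieces, which makes `π`
  -- defined on all of `X`.
  let T : X → ℕ → B := fun x k => Nat.rec top (fun k D => next k D (p k D x)) k
  let π : X → ℕ → ℕ := fun x k => p k (T x k) x
  have Ssucc : ∀ y k, S y (k + 1) = next k (S y k) (y k) := fun y k => rfl
  have Tsucc : ∀ x k, T x (k + 1) = next k (T x k) (p k (T x k) x) := fun x k => rfl
  have Scongr : ∀ {y y' : ℕ → ℕ} (k : ℕ), (∀ i < k, y' i = y i) → S y' k = S y k := by
    intro y y' k
    induction k with
    | zero => exact fun _ => rfl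
    | succ k ih =>
      intro h
      rw [Ssucc, Ssucc, ih fun i hi => h i (hi.trans (Nat.lt_succ_self k)),
        h k (Nat.lt_succ_self k)]
  have Smono : ∀ y, Antitone fun k => (S y k).1 := fun y =>
    antitone_nat_of_succ_le fun k => (hC k (S y k) (y k)).2.2.1
  have Sdist : ∀ y k, ∀ a ∈ (S y (k + 1)).1, ∀ b ∈ (S y (k + 1)).1,
      dist a b < 1 / ((k : ℝ) + 1) := fun y k => (hC k (S y k) (y k)).2.2.2.2
  have hpoint : ∀ y, ∃ x, ∀ k, x ∈ (S y k).1 := by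
    intro y
    have hne : ∀ k, (S y k).1.Nonempty := fun k => by
      rw [nonempty_iff_ne_empty]
      intro h
      exact (S y k).2.2 (h ▸ isSigmaCompact_empty)
    choose z hz using hne
    have hcauchy : CauchySeq fun k => z (k + 1) := by
      refine cauchySeq_of_le_tendsto_0 (fun k : ℕ => 1 / ((k : ℝ) + 1)) (fun i j N hi hj => ?_)
        tendsto_one_div_add_atTop_nhds_zero_nat
      exact (Sdist y N _ (Smono y (Nat.succ_le_succ hi) (hz (i + 1))) _
        (Smono y (Nat.succ_le_succ hj) (hz (j + 1)))).le
    obtain ⟨x, hx⟩ := cauchySeq_tendsto_of_complete hcauchy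
    refine ⟨x, fun k => (S y k).2.1.mem_of_tendsto hx ?_⟩
    filter_upwards [eventually_ge_atTop k] with j hj
    exact Smono y (hj.trans (Nat.le_succ j)) (hz (j + 1))
  choose σ hσS using hpoint
  refine ⟨π, σ, ?_, ?_, ?_⟩
  · have hT : ∀ k x, ∀ᶠ x' in 𝓝 x, T x' k = T x k := by
      intro k x
      induction k with
      | zero => exact Eventually.of_forall fun _ => rfl
      | succ k ih =>
        have hev : ∀ᶠ x' in 𝓝 x, p k (T x k) x' = p k (T x k) x :=
          (hp k (T x k)).continuousAt (mem_nhds_discrete.2 rfl : {p k (T x k) x} ∈ 𝓝 _)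
        filter_upwards [ih, hev] with x' h₁ h₂
        rw [Tsucc, Tsucc, h₁, h₂]
    refine continuous_pi fun k => continuous_iff_continuousAt.2 fun x => ?_
    refine (hp k (T x k)).continuousAt.congr ?_
    filter_upwards [hT k x] with x' hx'
    simp only [π, hx']
  · refine continuous_iff_continuousAt.2 fun y => Metric.tendsto_nhds.2 fun ε hε => ?_
    obtain ⟨k, hk⟩ := exists_nat_one_div_lt hε
    have hev : ∀ᶠ y' in 𝓝 y, ∀ i ∈ Finset.range (k + 1), y' i = y i :=
      (Finset.eventually_all _).2 fun i _ =>
        (continuous_apply i).continuousAt (mem_nhds_discrete.2 rfl : {y i} ∈ 𝓝 _)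
    filter_upwards [hev] with y' hy'
    have hS := Scongr (k + 1) fun i hi => hy' i (Finset.mem_range.2 hi)
    exact (Sdist y k _ (hS ▸ hσS y' (k + 1)) _ (hσS y (k + 1))).trans hk
  · intro y
    have hval : ∀ k, p k (S y k) (σ y) = y k := fun k =>
      (hC k (S y k) (y k)).2.2.2.1 _ (hσS y (k + 1))
    have hTS : ∀ k, T (σ y) k = S y k := by
      intro k
      induction k with
      | zero => rfl
      | succ k ih => rw [Tsucc, Ssucc, ih, hval]
    funext k
    simp only [π, hTS, hval]

end Retract

theorem propositionP {X : Type*} [TopologicalSpace X] [PolishSpace X]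
    (hX : TopologicalSpace.IsTopologicalBasis {U : Set X | IsClopen U}) :
    (∀ f : X → X, Continuous f → (∀ x : X, f x ≠ x) → IsColorable f) ↔
      SigmaCompactSpace X := by
  refine ⟨fun h => ?_, fun _ f hf hfix => isColorable_of_sigmaCompactSpace hX hf hfix⟩
  by_contra hσ
  obtain ⟨π, σ, hπ, hσ, hπσ⟩ := exists_baire_retract hX hσ
  refine not_isColorable_freeShift (IsColorable.of_conj hσ (fun y => ?_)
    (h (σ ∘ freeShift ∘ π) (hσ.comp (continuous_freeShift.comp hπ)) fun x hx => ?_))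
  · simp [hπσ]
  · exact freeShift_ne (π x) (by simpa [hπσ] using congrArg π hx)
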